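/- Let $p\in\mathbb N\cup\{0\}$, $m\ge 2$, let $a_0,\dots,a_m\in\mathbb R$ with $a_m\neq 0$, let $C_0,\dots,C_p\in\mathbb R$, and let $p<\alpha_1<\alpha_2<\dots<\alpha_m\le p+1$ be real. For $\alpha>0$ and $n=\lceil\alpha\rceil$ let $D^\alpha$ be the Caputo derivative with base point $0$: for $t>0$, $$D^\alpha f(t)=\frac1{\Gamma(n-\alpha)}\int_0^t (t-\tau)^{n-\alpha-1}f^{(n)}(\tau)\,d\tau\quad (n-1<\alpha<n),\qquad D^{n}f(t)=f^{(n)}(t).$$ For $n\geq 1$ let $\mathcal K_n$ be the set of real functions $f\in C^{n-1}[0,\infty)\cap C^{n}(0,\infty)$ such that $f^{(n)}$ is integrable on $(0,T]$ for every $T>0$ (it may be singular at $0$). Consider the multi-term equation, for $x\in\mathcal K_{p+1}$, $$a_0x(t)+a_1D^{\alpha_1}x(t)+\dots+a_mD^{\alpha_m}x(t)=0\quad(t>0),\qquad x^{(i)}(0)=C_i\ \ (0\le i\le p),\tag{1}$$ and the system of $m$ equations, for $x\in\mathcal K_{p+1}$ and $y_1,\dots,y_{m-1}\in\mathcal K_1$,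 $$\begin{aligned}D^{\alpha_1}x(t)&=y_1(t),\\ D^{\alpha_{j+1}-\alpha_j}y_j(t)&=y_{j+1}(t),\qquad j=1,\dots,m-2,\\ D^{\alpha_m-\alpha_{m-1}}y_{m-1}(t)&=-\tfrac1{a_m}\bigl[a_0x(t)+a_1y_1(t)+\dots+a_{m-1}y_{m-1}(t)\bigr]\end{aligned}\qquad(t>0)\tag{2}$$ with initial conditions $x^{(i)}(0)=C_i$ $(0\le i\le p)$ and $y_j(0)=0$ $(1\le j\le m-1)$. Then (1) and (2) are equivalent: a function $x$ solves (1) if and only if there are $y_1,\dots,y_{m-1}$ such that $(x,y_1,\dots,y_{m-1})$ solves (2). Moreover, in that case $y_1,\dots,y_{m-1}$ are determined by $x$: $y_j(t)=D^{\alpha_j}x(t)$ for $t>0$ and $1\le j\le m-1$. -/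

import Mathlib

open MeasureTheory Set

/-- The Caputo derivative of order `α` with base point `0`, where `n = ⌈α⌉`:
`(1 / Γ(n - α)) ∫₀ᵗ (t - τ)^(n - α - 1) f⁽ⁿ⁾(τ) dτ` if `n - 1 < α < n`, and `f⁽ⁿ⁾(t)` if `α = n`.
It is only used at times `t > 0` (so that only values of `f⁽ⁿ⁾` on `(0, t]` enter). -/
noncomputable def caputoDeriv (α : ℝ) (f : ℝ → ℝ) (t : ℝ) : ℝ :=
  if α = (⌈α⌉₊ : ℝ) then iteratedDeriv ⌈α⌉₊ f t
  else (1 / Real.Gamma ((⌈α⌉₊ : ℝ) - α)) *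
    ∫ τ in (0 : ℝ)..t, (t - τ) ^ ((⌈α⌉₊ : ℝ) - α - 1) * iteratedDeriv ⌈α⌉₊ f τ

/-- The functions on `[0, ∞)` to which Caputo derivatives of the orders in `(p, p + 1]` are applied:
`f` is `C^p` on `[0, ∞)` (one-sided at `0`), `C^(p + 1)` on `(0, ∞)`, and `f⁽ᵖ⁺¹⁾` is integrable on
`(0, T]` for every `T`. The derivative of order `p + 1` may be singular at `0`. -/
structure CaputoClass (p : ℕ) (f : ℝ → ℝ) : Prop where
  contDiffOn_Ici : ContDiffOn ℝ (p : ℕ) f (Ici 0)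
  contDiffOn_Ioi : ContDiffOn ℝ ((p + 1 : ℕ) : ℕ∞) f (Ioi 0)
  integrable : ∀ T : ℝ, 0 < T → IntervalIntegrable (iteratedDeriv (p + 1) f) volume 0 T

/-- `x` solves `a₀ x + a₁ D^{α₁} x + ⋯ + a_m D^{α_m} x = 0` on `(0, ∞)`,
with `x⁽ⁱ⁾(0) = C_i` for `i = 0, …, p`. -/
structure SolvesMultiTerm (p m : ℕ) (α a C : ℕ → ℝ) (x : ℝ → ℝ) : Prop where
  mem : CaputoClass p x
  init : ∀ i ≤ p, iteratedDerivWithin i x (Ici 0) 0 = C i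
  eqn : ∀ t : ℝ, 0 < t →
    a 0 * x t + ∑ k ∈ Finset.Icc 1 m, a k * caputoDeriv (α k) x t = 0

/-- `(x, y₁, …, y_{m-1})` solves, on `(0, ∞)`, the split system
`D^{α₁} x = y₁`, `D^{α_{j+1} - α_j} y_j = y_{j+1}` for `1 ≤ j ≤ m - 2`, and
`D^{α_m - α_{m-1}} y_{m-1} = -(1 / a_m) (a₀ x + a₁ y₁ + ⋯ + a_{m-1} y_{m-1})`,
with `x⁽ⁱ⁾(0) = C_i` for `i = 0, …, p` and `y_j(0) = 0` for `1 ≤ j ≤ m - 1`. -/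
structure SolvesSplitSystem (p m : ℕ) (α a C : ℕ → ℝ) (x : ℝ → ℝ) (y : ℕ → ℝ → ℝ) : Prop where
  mem_x : CaputoClass p x
  mem_y : ∀ j, 1 ≤ j → j ≤ m - 1 → CaputoClass 0 (y j)
  init_x : ∀ i ≤ p, iteratedDerivWithin i x (Ici 0) 0 = C i
  init_y : ∀ j, 1 ≤ j → j ≤ m - 1 → y j 0 = 0
  first : ∀ t : ℝ, 0 < t → caputoDeriv (α 1) x t = y 1 t
  middle : ∀ j, 1 ≤ j → j ≤ m - 2 → ∀ t : ℝ, 0 < t →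
    caputoDeriv (α (j + 1) - α j) (y j) t = y (j + 1) t
  last : ∀ t : ℝ, 0 < t →
    caputoDeriv (α m - α (m - 1)) (y (m - 1)) t =
      -(1 / a m) * (a 0 * x t + ∑ k ∈ Finset.Icc 1 (m - 1), a k * y k t)

/-!
For `p < α ≤ p + 1` the Caputo derivative `D^α x` is the Riemann–Liouville integral
`I^{p + 1 - α} g` of the single function `g = x⁽ᵖ⁺¹⁾`, which is continuous on `(0, ∞)` and
integrable near `0`. On such functions the integrals `I^s` form a semigroup
(`rlIntegral_rlIntegral`) and are injective (`eq_of_rlIntegral_eq`). If `y` is `C¹` on `(0, ∞)`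
with integrable derivative,
continuous at `0` with `y 0 = 0`, and `y = I^β g`, then
`I^γ (D^γ y) = I^γ I^{1 - γ} y' = I^1 y' = y = I^γ (I^{β - γ} g)`, so that `D^γ y = I^{β - γ} g`
(`CaputoClass.caputoDeriv_eq_rlIntegral_of_eq`). With this composition rule, induction on `j` shows
that `y_j = D^{α_j} x` in every solution of the system, and the last equation of the system becomes
the multi-term equation.

Conversely, let `x` solve the multi-term equation. The composition rule gives the system for
`y_j = D^{α_j} x`, once the `y_j` are known to be `C¹` on `(0, ∞)`, with integrable derivative and
with limit `0` at `0`. For a general `x` in the class this is false, and it has to be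
extracted from the equation. Put `h = D^{α_m} x`. Then `D^{α_j} x = I^{α_m - α_j} h`, and the
equation reads `h = f + ∑ c_j I^{α_m - α_j} h` where `f` is a multiple of `x`: a Volterra equation
of the second kind with weakly singular kernel. Call a function a primitive if it is a constant plus
the integral of a function continuous on `(0, ∞)` and integrable near `0`; fractional integrals of
primitives are primitives, and `x` is one. Now `I^s h` is a primitive for `s ≥ 1`, and applying
`I^s` to the equation transfers this from the orders `s + (α_m - α_j)` to `s`; after finitely
many steps `h = I^0 h` is a primitive (`volterraPrimitive_rlIntegral_of_eq`). Hence each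
`y_j = I^{α_m - α_j} h` with `j < m` is a primitive that vanishes at `0`.
-/

open Filter Topology
open scoped Convolution

/-! ### Fractional integrals as convolutions -/

/-- The real functions that are continuous on `(0, ∞)` and integrable on `(0, T]` for every `T`;
they may be singular at `0`, and their values on `(-∞, 0]` are irrelevant. -/
structure VolterraClass (v : ℝ → ℝ) : Prop where
  continuousOn : ContinuousOn v (Ioi 0)
  integrable : ∀ T : ℝ, 0 < T → IntervalIntegrable v volume 0 T

/-- The Riemann–Liouville fractional integral of order `s` with base point `0`,
`(1 / Γ(s)) ∫₀ᵗ (t - τ)^(s - 1) v(τ) dτ`. The order `s = 0` is the identity, which has to be set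
apart because `1 / Γ(0)` is the junk value `0`. -/
noncomputable def rlIntegral (s : ℝ) (v : ℝ → ℝ) (t : ℝ) : ℝ :=
  if s = 0 then v t
  else (1 / Real.Gamma s) * ∫ τ in (0 : ℝ)..t, (t - τ) ^ (s - 1) * v τ

/-- The kernel `r^(s - 1) / Γ(s)` of the fractional integral, extended by zero to `r ≤ 0`. -/
noncomputable def rlKernel (s : ℝ) : ℝ → ℝ :=
  (Ioi 0).indicator fun r => r ^ (s - 1) / Real.Gamma s

theorem rlIntegral_zero (v : ℝ → ℝ) : rlIntegral 0 v = v := by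
  funext t; simp [rlIntegral]

theorem rlIntegral_of_ne {s : ℝ} (hs : s ≠ 0) (v : ℝ → ℝ) (t : ℝ) :
    rlIntegral s v t = (1 / Real.Gamma s) * ∫ τ in (0 : ℝ)..t, (t - τ) ^ (s - 1) * v τ := by
  simp [rlIntegral, hs]

theorem rlIntegral_one (v : ℝ → ℝ) (t : ℝ) : rlIntegral 1 v t = ∫ τ in (0 : ℝ)..t, v τ := by
  simp [rlIntegral]

theorem rlIntegral_congr {s : ℝ} {u v : ℝ → ℝ} (h : ∀ t, 0 < t → u t = v t) {t : ℝ} (ht : 0 < t) :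
    rlIntegral s u t = rlIntegral s v t := by
  unfold rlIntegral
  split_ifs with hs
  · exact h t ht
  · congr 1
    refine intervalIntegral.integral_congr_ae (Eventually.of_forall fun τ hτ => ?_)
    rw [uIoc_of_le ht.le] at hτ
    rw [h τ hτ.1]

theorem VolterraClass.congr {u v : ℝ → ℝ} (hu : VolterraClass u) (h : ∀ t, 0 < t → v t = u t) :
    VolterraClass v where
  continuousOn := hu.continuousOn.congr h
  integrable T hT := (hu.integrable T hT).congr fun τ hτ => by
    rw [uIoc_of_le hT.le] at hτ
    exact (h τ hτ.1).symm

/-- The integral defining `rlIntegral s v t` converges: on `[0, t / 2]` the kernel is bounded, on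
`[t / 2, t]` the function `v` is. -/
theorem VolterraClass.intervalIntegrable_kernel_mul {v : ℝ → ℝ} (hv : VolterraClass v) {s t : ℝ}
    (hs : 0 < s) (ht : 0 < t) :
    IntervalIntegrable (fun τ => (t - τ) ^ (s - 1) * v τ) volume 0 t := by
  have h2 : 0 < t / 2 := by linarith
  refine IntervalIntegrable.trans (b := t / 2) ?_ ?_
  · refine (hv.integrable _ h2).continuousOn_mul fun τ hτ => ?_
    rw [uIcc_of_le h2.le] at hτ
    refine ContinuousAt.continuousWithinAt ?_
    exact (continuousAt_const.sub continuousAt_id).rpow_const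
      (Or.inl (by change t - τ ≠ 0; linarith [hτ.2]))
  · refine IntervalIntegrable.mul_continuousOn ?_ (hv.continuousOn.mono ?_)
    · have := (intervalIntegral.intervalIntegrable_rpow' (a := t / 2) (b := 0)
        (r := s - 1) (by linarith)).comp_sub_left t
      rwa [sub_half, sub_zero] at this
    · rw [uIcc_of_le (by linarith)]
      exact fun τ hτ => lt_of_lt_of_le h2 hτ.1

theorem indicator_mul_rlKernel (s : ℝ) (v : ℝ → ℝ) (t : ℝ) :
    (fun τ => (Ioi 0).indicator v τ * rlKernel s (t - τ)) =
      (Ioo 0 t).indicator fun τ => (1 / Real.Gamma s) * ((t - τ) ^ (s - 1) * v τ) := by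
  funext τ
  simp only [rlKernel, indicator, mem_Ioi, mem_Ioo, sub_pos]
  split_ifs <;> first | (exfalso; tauto) | (ring)

theorem VolterraClass.convolutionExistsAt {v : ℝ → ℝ} (hv : VolterraClass v) {s : ℝ} (hs : 0 < s)
    (t : ℝ) : ConvolutionExistsAt ((Ioi 0).indicator v) (rlKernel s) t
      (ContinuousLinearMap.mul ℝ ℝ) volume := by
  unfold ConvolutionExistsAt
  simp only [ContinuousLinearMap.mul_apply']
  rw [indicator_mul_rlKernel]
  rcases le_or_gt t 0 with ht | ht
  · simp [Ioo_eq_empty (not_lt.2 ht)]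
  · rw [integrable_indicator_iff measurableSet_Ioo]
    exact (((intervalIntegrable_iff_integrableOn_Ioo_of_le ht.le).1
      (hv.intervalIntegrable_kernel_mul hs ht)).const_mul _)

/-- The fractional integral is a convolution on the whole line of functions extended by zero. -/
theorem convolution_rlKernel {s : ℝ} (hs : 0 < s) (v : ℝ → ℝ) :
    ((Ioi 0).indicator v ⋆[ContinuousLinearMap.mul ℝ ℝ, volume] rlKernel s) =
      (Ioi 0).indicator (rlIntegral s v) := by
  funext t
  simp only [convolution, ContinuousLinearMap.mul_apply']
  rw [indicator_mul_rlKernel, integral_indicator measurableSet_Ioo]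
  rcases le_or_gt t 0 with ht | ht
  · simp [ht]
  · rw [indicator_of_mem (show t ∈ Ioi 0 from ht), rlIntegral_of_ne hs.ne',
      intervalIntegral.integral_of_le ht.le, integral_Ioc_eq_integral_Ioo, integral_const_mul]

theorem volterraClass_rlKernel {s : ℝ} (hs : 0 < s) : VolterraClass (rlKernel s) := by
  have h : VolterraClass fun r : ℝ => r ^ (s - 1) / Real.Gamma s := by
    constructor
    · intro r hr
      exact ((Real.continuousAt_rpow_const r _ (Or.inl (ne_of_gt hr))).div_const
        _).continuousWithinAt
    · intro T _
      exact (intervalIntegral.intervalIntegrable_rpow' (by linarith)).div_const _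
  exact h.congr fun t ht => indicator_of_mem ht _

theorem indicator_rlKernel (s : ℝ) : (Ioi 0).indicator (rlKernel s) = rlKernel s := by
  rw [rlKernel, indicator_indicator, inter_self]

theorem rlKernel_nonneg {s : ℝ} (hs : 0 < s) (r : ℝ) : 0 ≤ rlKernel s r :=
  indicator_nonneg (fun _ hr => div_nonneg (Real.rpow_nonneg (le_of_lt hr) _)
    (Real.Gamma_pos_of_pos hs).le) r

/-- Euler's beta integral on `[0, t]`. -/
theorem integral_rpow_mul_rpow {a b t : ℝ} (ha : 0 < a) (hb : 0 < b) (ht : 0 < t) :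
    ∫ τ in (0 : ℝ)..t, (t - τ) ^ (a - 1) * τ ^ (b - 1) =
      t ^ (a + b - 1) * (Real.Gamma a * Real.Gamma b / Real.Gamma (a + b)) := by
  have h := Complex.betaIntegral_scaled b a ht
  rw [Complex.betaIntegral_eq_Gamma_mul_div _ _ (by simpa) (by simpa)] at h
  have key : (((∫ τ in (0 : ℝ)..t, (t - τ) ^ (a - 1) * τ ^ (b - 1) : ℝ)) : ℂ) =
      ((t ^ (a + b - 1) * (Real.Gamma a * Real.Gamma b / Real.Gamma (a + b)) : ℝ) : ℂ) := by
    rw [← intervalIntegral.integral_ofReal]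
    convert! h using 1
    · refine intervalIntegral.integral_congr fun τ hτ => ?_
      rw [uIcc_of_le ht.le] at hτ
      rw [Complex.ofReal_mul, Complex.ofReal_cpow (sub_nonneg.2 hτ.2), Complex.ofReal_cpow hτ.1]
      push_cast
      ring
    · push_cast
      rw [Complex.ofReal_cpow ht.le]
      push_cast [← Complex.Gamma_ofReal]
      rw [add_comm (b : ℂ) a, mul_comm (Complex.Gamma b)]
  exact_mod_cast key

theorem rlIntegral_rlKernel {a b : ℝ} (ha : 0 < a) (hb : 0 < b) {t : ℝ} (ht : 0 < t) :
    rlIntegral a (rlKernel b) t = rlKernel (a + b) t := by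
  have hΓa := (Real.Gamma_pos_of_pos ha).ne'
  have hΓb := (Real.Gamma_pos_of_pos hb).ne'
  rw [rlIntegral_congr (v := fun r => r ^ (b - 1) / Real.Gamma b)
    (fun r hr => indicator_of_mem (show r ∈ Ioi 0 from hr) _) ht, rlIntegral_of_ne ha.ne', rlKernel,
    indicator_of_mem (show t ∈ Ioi 0 from ht)]
  simp_rw [← mul_div_assoc]
  rw [intervalIntegral.integral_div, integral_rpow_mul_rpow ha hb ht]
  field_simp

theorem convolution_rlKernel_rlKernel {a b : ℝ} (ha : 0 < a) (hb : 0 < b) :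
    (rlKernel b ⋆[ContinuousLinearMap.mul ℝ ℝ, volume] rlKernel a) = rlKernel (a + b) := by
  rw [← indicator_rlKernel b, convolution_rlKernel ha, ← indicator_rlKernel (a + b)]
  exact indicator_congr fun t ht => rlIntegral_rlKernel ha hb ht

theorem VolterraClass.norm {v : ℝ → ℝ} (hv : VolterraClass v) : VolterraClass fun t => ‖v t‖ :=
  ⟨hv.continuousOn.norm, fun T hT => (hv.integrable T hT).norm⟩

theorem VolterraClass.aestronglyMeasurable {v : ℝ → ℝ} (hv : VolterraClass v) :
    AEStronglyMeasurable ((Ioi 0).indicator v) volume :=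
  (aestronglyMeasurable_indicator_iff measurableSet_Ioi).2
    (hv.continuousOn.aestronglyMeasurable measurableSet_Ioi)

/-- The semigroup property of fractional integrals. It holds at every `t > 0`, not just almost
everywhere: it is the associativity of convolution, and all the convolutions involved exist
pointwise. -/
theorem rlIntegral_rlIntegral {a b : ℝ} (ha : 0 ≤ a) (hb : 0 ≤ b) {v : ℝ → ℝ}
    (hv : VolterraClass v) {t : ℝ} (ht : 0 < t) :
    rlIntegral a (rlIntegral b v) t = rlIntegral (a + b) v t := by
  rcases ha.eq_or_lt with rfl | ha
  · rw [rlIntegral_zero, zero_add]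
  rcases hb.eq_or_lt with rfl | hb
  · rw [rlIntegral_zero, add_zero]
  have hk (s : ℝ) (hs : 0 < s) : (fun x => ‖rlKernel s x‖) = rlKernel s :=
    funext fun x => Real.norm_of_nonneg (rlKernel_nonneg hs x)
  have hn : (fun x => ‖(Ioi 0).indicator v x‖) = (Ioi 0).indicator fun x => ‖v x‖ :=
    funext fun x => norm_indicator_eq_indicator_norm v x
  have hmeas (s : ℝ) (hs : 0 < s) : AEStronglyMeasurable (rlKernel s) volume := by
    rw [← indicator_rlKernel]
    exact (volterraClass_rlKernel hs).aestronglyMeasurable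
  have key := convolution_assoc (ContinuousLinearMap.mul ℝ ℝ) (ContinuousLinearMap.mul ℝ ℝ)
    (ContinuousLinearMap.mul ℝ ℝ) (ContinuousLinearMap.mul ℝ ℝ) (x₀ := t)
    (f := (Ioi 0).indicator v) (g := rlKernel b) (k := rlKernel a) (μ := volume) (ν := volume)
    (fun x y z => by simp [mul_assoc]) hv.aestronglyMeasurable (hmeas b hb) (hmeas a ha)
    (Eventually.of_forall fun y => hv.convolutionExistsAt hb y)
    (Eventually.of_forall fun y => by
      rw [hk a ha, hk b hb, ← indicator_rlKernel b]
      exact (volterraClass_rlKernel hb).convolutionExistsAt ha y)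
    (by
      rw [hk a ha, hk b hb, convolution_rlKernel_rlKernel ha hb, hn]
      exact hv.norm.convolutionExistsAt (add_pos ha hb) t)
  rw [convolution_rlKernel hb, convolution_rlKernel ha, convolution_rlKernel_rlKernel ha hb,
    convolution_rlKernel (add_pos ha hb)] at key
  simpa [ht] using key

/-! ### Fractional integrals preserve continuity and integrability -/

/-- Continuity for a continuous integrand: after the substitution `τ = t σ` the singularity of the
kernel no longer moves with `t`, and dominated convergence applies. -/
theorem continuousOn_integral_kernel_mul {w : ℝ → ℝ} (hw : Continuous w) {s : ℝ} (hs : 0 < s) :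
    ContinuousOn (fun t => ∫ τ in (0 : ℝ)..t, (t - τ) ^ (s - 1) * w τ) (Ioi 0) := by
  have hscale : ∀ t ∈ Ioi (0 : ℝ), ∫ τ in (0 : ℝ)..t, (t - τ) ^ (s - 1) * w τ =
      t * (t ^ (s - 1) * ∫ σ in (0 : ℝ)..1, (1 - σ) ^ (s - 1) * w (t * σ)) := by
    intro t ht
    have h := intervalIntegral.smul_integral_comp_mul_left (a := 0) (b := 1)
      (f := fun τ => (t - τ) ^ (s - 1) * w τ) (c := t)
    rw [mul_zero, mul_one] at h
    rw [← h, smul_eq_mul, ← intervalIntegral.integral_const_mul (t ^ (s - 1))]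
    congr 1
    refine intervalIntegral.integral_congr fun σ hσ => ?_
    rw [uIcc_of_le zero_le_one] at hσ
    rw [show t - t * σ = t * (1 - σ) by ring,
      Real.mul_rpow (le_of_lt ht) (sub_nonneg.2 hσ.2), mul_assoc]
  refine ContinuousOn.congr (fun t ht => ContinuousAt.continuousWithinAt ?_) hscale
  have ht : 0 < t := ht
  refine continuousAt_id.mul ((Real.continuousAt_rpow_const t _ (Or.inl ht.ne')).mul ?_)
  obtain ⟨B, hB⟩ := (isCompact_Icc (a := (0 : ℝ)) (b := 2 * t)).exists_bound_of_continuousOn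
    hw.continuousOn
  have hker : IntervalIntegrable (fun σ : ℝ => (1 - σ) ^ (s - 1)) volume 0 1 := by
    have := (intervalIntegral.intervalIntegrable_rpow' (a := 1) (b := 0)
      (r := s - 1) (by linarith)).comp_sub_left 1
    rwa [sub_self, sub_zero] at this
  refine intervalIntegral.continuousAt_of_dominated_interval
    (bound := fun σ => (1 - σ) ^ (s - 1) * B) ?_ ?_ (hker.mul_const B) ?_
  · refine Eventually.of_forall fun x => ?_
    exact (intervalIntegrable_iff.1 (hker.mul_continuousOn
      (hw.comp (continuous_const.mul continuous_id)).continuousOn)).aestronglyMeasurable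
  · filter_upwards [Ioo_mem_nhds ht (show t < 2 * t by linarith)] with x hx
    refine Eventually.of_forall fun σ hσ => ?_
    rw [uIoc_of_le zero_le_one] at hσ
    have h1 : 0 ≤ (1 - σ) ^ (s - 1) := Real.rpow_nonneg (sub_nonneg.2 hσ.2) _
    rw [norm_mul, Real.norm_of_nonneg h1]
    exact mul_le_mul_of_nonneg_left
      (hB _ ⟨mul_nonneg hx.1.le hσ.1.le, by nlinarith [hx.1, hx.2, hσ.1, hσ.2]⟩) h1
  · refine Eventually.of_forall fun σ _ => ?_
    exact continuousAt_const.mul (hw.comp (continuous_id.mul continuous_const)).continuousAt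

/-- Continuity for an integrand supported away from `t`, where the kernel is not singular. -/
theorem continuousAt_integral_kernel_mul_left {u : ℝ → ℝ} {d t : ℝ} (hd : 0 ≤ d) (hdt : d < t)
    (hu : IntervalIntegrable u volume 0 d) (s : ℝ) :
    ContinuousAt (fun x => ∫ τ in (0 : ℝ)..d, (x - τ) ^ (s - 1) * u τ) t := by
  have hc (x : ℝ) (hx : d < x) : ContinuousOn (fun τ => (x - τ) ^ (s - 1)) (uIcc 0 d) := by
    intro τ hτ
    rw [uIcc_of_le hd] at hτ
    exact (continuousAt_const.sub continuousAt_id).rpow_const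
      (Or.inl (by change x - τ ≠ 0; linarith [hτ.2])) |>.continuousWithinAt
  obtain ⟨B, hB⟩ := (isCompact_Icc (a := (t - d) / 2) (b := 2 * t)).exists_bound_of_continuousOn
    (f := fun r : ℝ => r ^ (s - 1)) fun r hr =>
      (Real.continuousAt_rpow_const r _ (Or.inl (by linarith [hr.1]))).continuousWithinAt
  refine intervalIntegral.continuousAt_of_dominated_interval
    (bound := fun τ => B * ‖u τ‖) ?_ ?_ (hu.norm.const_mul B) ?_
  · filter_upwards [Ioi_mem_nhds hdt] with x hx
    exact (intervalIntegrable_iff.1 (hu.continuousOn_mul (hc x hx))).aestronglyMeasurable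
  · filter_upwards [Ioo_mem_nhds (show (t + d) / 2 < t by linarith)
      (show t < 2 * t by linarith)] with x hx
    refine Eventually.of_forall fun τ hτ => ?_
    rw [uIoc_of_le hd] at hτ
    rw [norm_mul]
    exact mul_le_mul_of_nonneg_right (hB _ ⟨by linarith [hx.1, hτ.2], by linarith [hx.2, hτ.1]⟩)
      (norm_nonneg _)
  · refine Eventually.of_forall fun τ hτ => ?_
    rw [uIoc_of_le hd] at hτ
    exact ((continuousAt_id.sub continuousAt_const).rpow_const
      (Or.inl (by change t - τ ≠ 0; linarith [hτ.2]))).mul continuousAt_const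

/-- Near `t` the integrand is split into a continuous function and a function supported in
`[0, t / 2]`. -/
theorem VolterraClass.continuousOn_rlIntegral {v : ℝ → ℝ} (hv : VolterraClass v) {s : ℝ}
    (hs : 0 < s) : ContinuousOn (rlIntegral s v) (Ioi 0) := by
  intro t ht
  have ht : 0 < t := ht
  refine ContinuousAt.continuousWithinAt ?_
  set d := t / 2 with hd
  have hd0 : 0 < d := by linarith
  -- `w` is continuous on `ℝ` and agrees with `v` on `[d, ∞)`.
  set w : ℝ → ℝ := fun τ => v (max τ d) with hw_def
  have hw : Continuous w := hv.continuousOn.comp_continuous (continuous_id.max continuous_const)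
    fun τ => lt_of_lt_of_le hd0 (le_max_right _ _)
  have hwv : VolterraClass w := ⟨hw.continuousOn, fun T _ => hw.intervalIntegrable _ _⟩
  have hsplit : ∀ x, d < x → rlIntegral s v x = (1 / Real.Gamma s) *
      ((∫ τ in (0 : ℝ)..d, (x - τ) ^ (s - 1) * (v τ - w τ)) +
        ∫ τ in (0 : ℝ)..x, (x - τ) ^ (s - 1) * w τ) := by
    intro x hx
    have hx0 : 0 < x := hd0.trans hx
    have iv := hv.intervalIntegrable_kernel_mul hs hx0
    have iw := hwv.intervalIntegrable_kernel_mul hs hx0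
    have hsub := intervalIntegral.integral_sub iv iw
    have h0d : uIcc 0 d ⊆ uIcc 0 x := uIcc_subset_uIcc_left
      (by rw [uIcc_of_le hx0.le]; exact ⟨hd0.le, hx.le⟩)
    have hdx : uIcc d x ⊆ uIcc 0 x := uIcc_subset_uIcc_right
      (by rw [uIcc_of_le hx0.le]; exact ⟨hd0.le, hx.le⟩)
    rw [← intervalIntegral.integral_add_adjacent_intervals ((iv.sub iw).mono_set h0d)
      ((iv.sub iw).mono_set hdx)] at hsub
    have hz : ∫ τ in d..x, ((x - τ) ^ (s - 1) * v τ - (x - τ) ^ (s - 1) * w τ) = 0 := by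
      rw [intervalIntegral.integral_congr (g := fun _ => 0), intervalIntegral.integral_zero]
      intro τ hτ
      rw [uIcc_of_le hx.le] at hτ
      simp [hw_def, max_eq_left hτ.1]
    rw [hz, add_zero] at hsub
    rw [rlIntegral_of_ne hs.ne']
    simp_rw [mul_sub]
    rw [hsub]
    ring
  have hdt : d < t := by linarith
  have hc : ContinuousAt (fun x => (1 / Real.Gamma s) *
      ((∫ τ in (0 : ℝ)..d, (x - τ) ^ (s - 1) * (v τ - w τ)) +
        ∫ τ in (0 : ℝ)..x, (x - τ) ^ (s - 1) * w τ)) t :=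
    continuousAt_const.mul ((continuousAt_integral_kernel_mul_left hd0.le hdt
      ((hv.integrable d hd0).sub (hwv.integrable d hd0)) s).add
      ((continuousOn_integral_kernel_mul hw hs).continuousAt (Ioi_mem_nhds ht)))
  refine hc.congr ?_
  filter_upwards [Ioi_mem_nhds hdt] with x hx
  exact (hsplit x hx).symm

theorem VolterraClass.volterraClass_rlIntegral {v : ℝ → ℝ} (hv : VolterraClass v) {s : ℝ}
    (hs : 0 ≤ s) : VolterraClass (rlIntegral s v) := by
  rcases hs.eq_or_lt with rfl | hs
  · rwa [rlIntegral_zero]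
  refine ⟨hv.continuousOn_rlIntegral hs, fun T hT => ?_⟩
  have htrunc {u : ℝ → ℝ} (hu : VolterraClass u) : Integrable ((Ioc 0 T).indicator u) volume :=
    (integrable_indicator_iff measurableSet_Ioc).2
      ((intervalIntegrable_iff_integrableOn_Ioc_of_le hT.le).1 (hu.integrable T hT))
  -- On `(0, T]` the convolution only sees the restrictions of `v` and of the kernel to `(0, T]`.
  have hint := (htrunc hv).integrable_convolution (ContinuousLinearMap.mul ℝ ℝ)
    (htrunc (volterraClass_rlKernel hs))
  rw [intervalIntegrable_iff_integrableOn_Ioc_of_le hT.le]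
  refine hint.integrableOn.congr_fun (fun t ht => ?_) measurableSet_Ioc
  have h1 : rlIntegral s v t =
      ((Ioi 0).indicator v ⋆[ContinuousLinearMap.mul ℝ ℝ, volume] rlKernel s) t := by
    rw [convolution_rlKernel hs, indicator_of_mem (show t ∈ Ioi 0 from ht.1)]
  rw [h1]
  refine integral_congr_ae (Eventually.of_forall fun τ => ?_)
  simp only [ContinuousLinearMap.mul_apply', rlKernel, indicator, mem_Ioi, mem_Ioc]
  have := ht.2
  split_ifs <;> first | rfl | (exfalso; grind) | simp

/-! ### Linearity of fractional integrals -/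

theorem VolterraClass.add {u v : ℝ → ℝ} (hu : VolterraClass u) (hv : VolterraClass v) :
    VolterraClass fun t => u t + v t :=
  ⟨hu.continuousOn.add hv.continuousOn, fun T hT => (hu.integrable T hT).add (hv.integrable T hT)⟩

theorem VolterraClass.const_mul {v : ℝ → ℝ} (hv : VolterraClass v) (c : ℝ) :
    VolterraClass fun t => c * v t :=
  ⟨continuousOn_const.mul hv.continuousOn, fun T hT => (hv.integrable T hT).const_mul c⟩

theorem volterraClass_const (c : ℝ) : VolterraClass fun _ => c :=
  ⟨continuousOn_const, fun _ _ => intervalIntegrable_const⟩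

theorem VolterraClass.sum {ι : Type*} (S : Finset ι) {v : ι → ℝ → ℝ}
    (hv : ∀ k ∈ S, VolterraClass (v k)) : VolterraClass fun t => ∑ k ∈ S, v k t := by
  classical
  induction S using Finset.induction_on with
  | empty => simpa using volterraClass_const 0
  | insert k S hk ih =>
    simp_rw [Finset.sum_insert hk]
    exact (hv k (Finset.mem_insert_self k S)).add
      (ih fun j hj => hv j (Finset.mem_insert_of_mem hj))

theorem rlIntegral_add {u v : ℝ → ℝ} (hu : VolterraClass u) (hv : VolterraClass v) {s t : ℝ}
    (hs : 0 ≤ s) (ht : 0 < t) :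
    rlIntegral s (fun τ => u τ + v τ) t = rlIntegral s u t + rlIntegral s v t := by
  rcases hs.eq_or_lt with rfl | hs
  · simp only [rlIntegral_zero]
  simp only [rlIntegral_of_ne hs.ne', mul_add]
  rw [intervalIntegral.integral_add (hu.intervalIntegrable_kernel_mul hs ht)
    (hv.intervalIntegrable_kernel_mul hs ht), mul_add]

theorem rlIntegral_const_mul (s c : ℝ) (v : ℝ → ℝ) (t : ℝ) :
    rlIntegral s (fun τ => c * v τ) t = c * rlIntegral s v t := by
  unfold rlIntegral
  split_ifs
  · rfl
  · simp_rw [mul_left_comm _ c]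
    rw [intervalIntegral.integral_const_mul, mul_left_comm]

theorem rlIntegral_sum {ι : Type*} (S : Finset ι) {v : ι → ℝ → ℝ}
    (hv : ∀ k ∈ S, VolterraClass (v k)) {s t : ℝ} (hs : 0 ≤ s) (ht : 0 < t) :
    rlIntegral s (fun τ => ∑ k ∈ S, v k τ) t = ∑ k ∈ S, rlIntegral s (v k) t := by
  classical
  induction S using Finset.induction_on with
  | empty => simp [rlIntegral]
  | insert k S hk ih =>
    simp_rw [Finset.sum_insert hk]
    rw [rlIntegral_add (hv k (Finset.mem_insert_self k S))
      (VolterraClass.sum S fun j hj => hv j (Finset.mem_insert_of_mem hj)) hs ht,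
      ih fun j hj => hv j (Finset.mem_insert_of_mem hj)]

/-- The fractional integral of a constant, written as a primitive of the kernel. -/
theorem rlIntegral_const {s : ℝ} (hs : 0 < s) (c : ℝ) {t : ℝ} (ht : 0 < t) :
    rlIntegral s (fun _ => c) t = ∫ τ in (0 : ℝ)..t, c * rlKernel s τ := by
  have h : ∫ τ in (0 : ℝ)..t, rlKernel s τ = ∫ τ in (0 : ℝ)..t, τ ^ (s - 1) / Real.Gamma s := by
    refine intervalIntegral.integral_congr_ae (Eventually.of_forall fun τ hτ => ?_)
    rw [uIoc_of_le ht.le] at hτ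
    exact indicator_of_mem (show τ ∈ Ioi 0 from hτ.1) _
  rw [rlIntegral_of_ne hs.ne', intervalIntegral.integral_mul_const,
    intervalIntegral.integral_const_mul, h, intervalIntegral.integral_div,
    intervalIntegral.integral_comp_sub_left (fun r => r ^ (s - 1)) t, sub_self, sub_zero]
  ring

/-! ### Primitives and regularity for Volterra equations -/

/-- The functions that are, on `(0, ∞)`, a constant plus the primitive from `0` of a function of
`VolterraClass`. They are `C¹` on `(0, ∞)`, with a limit at `0` and a derivative integrable
near `0`. -/
def VolterraPrimitive (u : ℝ → ℝ) : Prop :=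
  ∃ (c : ℝ) (v : ℝ → ℝ), VolterraClass v ∧ ∀ t, 0 < t → u t = c + ∫ τ in (0 : ℝ)..t, v τ

theorem VolterraClass.hasDerivAt_integral {v : ℝ → ℝ} (hv : VolterraClass v) {t : ℝ}
    (ht : 0 < t) : HasDerivAt (fun x => ∫ τ in (0 : ℝ)..x, v τ) (v t) t :=
  intervalIntegral.integral_hasDerivAt_right (hv.integrable t ht)
    (hv.continuousOn.stronglyMeasurableAtFilter isOpen_Ioi t ht)
    (hv.continuousOn.continuousAt (Ioi_mem_nhds ht))

theorem VolterraPrimitive.congr {u v : ℝ → ℝ} (hu : VolterraPrimitive u)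
    (h : ∀ t, 0 < t → v t = u t) : VolterraPrimitive v := by
  obtain ⟨c, w, hw, he⟩ := hu
  exact ⟨c, w, hw, fun t ht => (h t ht).trans (he t ht)⟩

theorem VolterraPrimitive.add {u v : ℝ → ℝ} (hu : VolterraPrimitive u)
    (hv : VolterraPrimitive v) : VolterraPrimitive fun t => u t + v t := by
  obtain ⟨c, w, hw, he⟩ := hu
  obtain ⟨c', w', hw', he'⟩ := hv
  refine ⟨c + c', fun t => w t + w' t, hw.add hw', fun t ht => ?_⟩
  simp only
  rw [he t ht, he' t ht, intervalIntegral.integral_add (hw.integrable t ht) (hw'.integrable t ht)]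
  ring

theorem VolterraPrimitive.const_mul {u : ℝ → ℝ} (hu : VolterraPrimitive u) (a : ℝ) :
    VolterraPrimitive fun t => a * u t := by
  obtain ⟨c, w, hw, he⟩ := hu
  refine ⟨a * c, fun t => a * w t, hw.const_mul a, fun t ht => ?_⟩
  simp only
  rw [he t ht, intervalIntegral.integral_const_mul, mul_add]

theorem VolterraPrimitive.sum {ι : Type*} (S : Finset ι) {u : ι → ℝ → ℝ}
    (hu : ∀ k ∈ S, VolterraPrimitive (u k)) : VolterraPrimitive fun t => ∑ k ∈ S, u k t := by
  classical
  induction S using Finset.induction_on with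
  | empty => exact ⟨0, fun _ => 0, volterraClass_const 0, by simp⟩
  | insert k S hk ih =>
    simp_rw [Finset.sum_insert hk]
    exact (hu k (Finset.mem_insert_self k S)).add
      (ih fun j hj => hu j (Finset.mem_insert_of_mem hj))

theorem VolterraClass.volterraPrimitive_rlIntegral {v : ℝ → ℝ} (hv : VolterraClass v) {s : ℝ}
    (hs : 1 ≤ s) : VolterraPrimitive (rlIntegral s v) := by
  refine ⟨0, rlIntegral (s - 1) v, hv.volterraClass_rlIntegral (by linarith), fun t ht => ?_⟩
  rw [zero_add, ← rlIntegral_one, rlIntegral_rlIntegral zero_le_one (by linarith) hv ht,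
    add_sub_cancel]

theorem VolterraClass.integral {v : ℝ → ℝ} (hv : VolterraClass v) :
    VolterraClass fun t => ∫ τ in (0 : ℝ)..t, v τ :=
  (hv.volterraClass_rlIntegral zero_le_one).congr fun t _ => (rlIntegral_one v t).symm

theorem VolterraPrimitive.volterraClass {u : ℝ → ℝ} (hu : VolterraPrimitive u) :
    VolterraClass u := by
  obtain ⟨c, v, hv, he⟩ := hu
  exact ((volterraClass_const c).add hv.integral).congr he

/-- A fractional integral of positive order of `c + ∫ v` is a primitive vanishing at `0`, namely
that of `c · rlKernel s + rlIntegral s v`. -/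
theorem VolterraPrimitive.exists_rlIntegral_eq {u : ℝ → ℝ} (hu : VolterraPrimitive u) {s : ℝ}
    (hs : 0 < s) :
    ∃ w, VolterraClass w ∧ ∀ t, 0 < t → rlIntegral s u t = ∫ τ in (0 : ℝ)..t, w τ := by
  obtain ⟨c, v, hv, he⟩ := hu
  have hk := (volterraClass_rlKernel hs).const_mul c
  have hI := hv.volterraClass_rlIntegral hs.le
  refine ⟨_, hk.add hI, fun t ht => ?_⟩
  rw [rlIntegral_congr he ht, rlIntegral_add (volterraClass_const c) hv.integral hs.le ht,
    rlIntegral_const hs c ht, intervalIntegral.integral_add (hk.integrable t ht)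
    (hI.integrable t ht), ← rlIntegral_one (rlIntegral s v),
    rlIntegral_rlIntegral zero_le_one hs.le hv ht, add_comm 1 s,
    ← rlIntegral_rlIntegral hs.le zero_le_one hv ht]
  congr 1
  exact rlIntegral_congr (fun t _ => (rlIntegral_one v t).symm) ht

theorem VolterraPrimitive.volterraPrimitive_rlIntegral {u : ℝ → ℝ} (hu : VolterraPrimitive u)
    {s : ℝ} (hs : 0 ≤ s) : VolterraPrimitive (rlIntegral s u) := by
  rcases hs.eq_or_lt with rfl | hs
  · rwa [rlIntegral_zero]
  obtain ⟨w, hw, he⟩ := hu.exists_rlIntegral_eq hs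
  exact ⟨0, w, hw, fun t ht => by rw [he t ht, zero_add]⟩

/-- Regularity for the Volterra equation of the second kind `h = f + ∑ c_k I^{γ_k} h`: if `f` is a
primitive, so are `h` and all its fractional integrals. The order is lowered step by step: `I^s h`
is a primitive for `s ≥ 1`, and applying `I^s` to the equation carries the property from the orders
`s + γ_k` down to `s`. -/
theorem volterraPrimitive_rlIntegral_of_eq {ι : Type*} {S : Finset ι} {c γ : ι → ℝ}
    {f h : ℝ → ℝ} (hh : VolterraClass h) (hf : VolterraPrimitive f) (hγ : ∀ k ∈ S, 0 < γ k)
    (heq : ∀ t, 0 < t → h t = f t + ∑ k ∈ S, c k * rlIntegral (γ k) h t) {s : ℝ} (hs : 0 ≤ s) :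
    VolterraPrimitive (rlIntegral s h) := by
  obtain ⟨g, hg, hgγ⟩ : ∃ g : ℝ, 0 < g ∧ ∀ k ∈ S, g ≤ γ k := by
    rcases S.eq_empty_or_nonempty with rfl | hS
    · exact ⟨1, one_pos, by simp⟩
    · obtain ⟨k, hk, hmin⟩ := S.exists_min_image γ hS
      exact ⟨γ k, hγ k hk, hmin⟩
  have main (n : ℕ) : ∀ s : ℝ, 0 ≤ s → 1 ≤ s + n * g → VolterraPrimitive (rlIntegral s h) := by
    induction n with
    | zero => exact fun s _ h1 => hh.volterraPrimitive_rlIntegral (by simpa using h1)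
    | succ n ih =>
      intro s hs h1
      push_cast at h1
      have hterm (k) (hk : k ∈ S) : VolterraClass fun t => c k * rlIntegral (γ k) h t :=
        (hh.volterraClass_rlIntegral (hγ k hk).le).const_mul (c k)
      refine ((hf.volterraPrimitive_rlIntegral hs).add (VolterraPrimitive.sum S fun k hk =>
        (ih (s + γ k) (add_nonneg hs (hγ k hk).le) ?_).const_mul (c k))).congr fun t ht => ?_
      · linarith [hgγ k hk]
      · rw [rlIntegral_congr heq ht, rlIntegral_add hf.volterraClass (VolterraClass.sum S hterm)
          hs ht, rlIntegral_sum S hterm hs ht]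
        congr 1
        refine Finset.sum_congr rfl fun k hk => ?_
        rw [rlIntegral_const_mul, rlIntegral_rlIntegral hs (hγ k hk).le hh ht]
  obtain ⟨n, hn⟩ := exists_nat_ge (1 / g)
  refine main n s hs ?_
  rw [div_le_iff₀ hg] at hn
  linarith

/-! ### Injectivity of fractional integration -/

/-- Fractional integration of order `s ∈ [0, 1]` is injective: applying the integral of order
`1 - s` reduces it to ordinary integration, which is undone by differentiating. -/
theorem eq_of_rlIntegral_eq {u v : ℝ → ℝ} (hu : VolterraClass u) (hv : VolterraClass v) {s : ℝ}
    (hs : 0 ≤ s) (hs1 : s ≤ 1) (h : ∀ t, 0 < t → rlIntegral s u t = rlIntegral s v t) {t : ℝ}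
    (ht : 0 < t) : u t = v t := by
  have key (x : ℝ) (hx : 0 < x) : ∫ τ in (0 : ℝ)..x, u τ = ∫ τ in (0 : ℝ)..x, v τ := by
    have h1 := rlIntegral_congr (s := 1 - s) h hx
    rwa [rlIntegral_rlIntegral (by linarith) hs hu hx, rlIntegral_rlIntegral (by linarith) hs hv hx,
      sub_add_cancel, rlIntegral_one, rlIntegral_one] at h1
  refine (hu.hasDerivAt_integral ht).unique ((hv.hasDerivAt_integral ht).congr_of_eventuallyEq ?_)
  filter_upwards [Ioi_mem_nhds ht] with x hx using key x hx

/-! ### Caputo derivatives as fractional integrals -/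

theorem CaputoClass.volterraClass_iteratedDeriv {p : ℕ} {x : ℝ → ℝ} (hx : CaputoClass p x) :
    VolterraClass (iteratedDeriv (p + 1) x) := by
  refine ⟨?_, hx.integrable⟩
  refine (hx.contDiffOn_Ioi.continuousOn_iteratedDerivWithin (m := p + 1) le_rfl
    (uniqueDiffOn_Ioi 0)).congr fun t ht => ?_
  exact (iteratedDerivWithin_of_isOpen isOpen_Ioi ht).symm

/-- On `(p, p + 1]` the Caputo derivative is a fractional integral of `x⁽ᵖ⁺¹⁾`; the two cases of its
definition correspond to those of `rlIntegral`. -/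
theorem caputoDeriv_eq_rlIntegral {p : ℕ} {α : ℝ} (h1 : (p : ℝ) < α) (h2 : α ≤ p + 1)
    (x : ℝ → ℝ) (t : ℝ) :
    caputoDeriv α x t = rlIntegral (p + 1 - α) (iteratedDeriv (p + 1) x) t := by
  have hc : ⌈α⌉₊ = p + 1 := by
    rw [Nat.ceil_eq_iff (Nat.succ_ne_zero p)]
    exact ⟨by simpa using h1, by exact_mod_cast h2⟩
  unfold caputoDeriv rlIntegral
  rw [hc]
  push_cast
  by_cases h : α = p + 1
  · rw [if_pos h, if_pos (by linarith)]
  · rw [if_neg h, if_neg (fun h' => h (by linarith))]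

theorem caputoDeriv_eq_rlIntegral_deriv {α : ℝ} (h1 : 0 < α) (h2 : α ≤ 1)
    (x : ℝ → ℝ) (t : ℝ) : caputoDeriv α x t = rlIntegral (1 - α) (deriv x) t := by
  have := caputoDeriv_eq_rlIntegral (p := 0) (by simpa using h1) (by simpa using h2) x t
  simpa [iteratedDeriv_one] using this

theorem CaputoClass.volterraClass_deriv {y : ℝ → ℝ} (hy : CaputoClass 0 y) :
    VolterraClass (deriv y) := by
  simpa [iteratedDeriv_one] using hy.volterraClass_iteratedDeriv

theorem CaputoClass.eq_add_integral {y : ℝ → ℝ} (hy : CaputoClass 0 y) {t : ℝ} (ht : 0 ≤ t) :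
    y t = y 0 + ∫ τ in (0 : ℝ)..t, deriv y τ := by
  rcases ht.eq_or_lt with rfl | ht
  · simp
  rw [intervalIntegral.integral_eq_sub_of_hasDerivAt_of_le ht.le
    (hy.contDiffOn_Ici.continuousOn.mono Icc_subset_Ici_self) (fun x hx => ?_)
    (hy.volterraClass_deriv.integrable t ht), add_sub_cancel]
  exact ((hy.contDiffOn_Ioi.differentiableOn (by simp)).differentiableAt
    (Ioi_mem_nhds hx.1)).hasDerivAt

theorem CaputoClass.zero {p : ℕ} {x : ℝ → ℝ} (hx : CaputoClass p x) : CaputoClass 0 x := by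
  rcases p with _ | p
  · exact hx
  refine ⟨hx.contDiffOn_Ici.of_le (by simp), hx.contDiffOn_Ioi.of_le ?_, fun T hT => ?_⟩
  · exact_mod_cast (by omega : 0 + 1 ≤ p + 1 + 1)
  · -- For `p ≥ 1` the one-sided derivative is continuous up to `0`, hence integrable near `0`.
    have hc := (hx.contDiffOn_Ici.continuousOn_derivWithin (uniqueDiffOn_Ici 0)
      (by exact_mod_cast (by omega : 1 ≤ p + 1))).mono (Icc_subset_Ici_self (a := T) (b := (0 : ℝ)))
    rw [zero_add, iteratedDeriv_one]
    rw [← uIcc_of_le hT.le] at hc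
    refine hc.intervalIntegrable.congr fun τ hτ => ?_
    rw [uIoc_of_le hT.le] at hτ
    exact derivWithin_of_mem_nhds (Ici_mem_nhds hτ.1)

theorem CaputoClass.volterraPrimitive {p : ℕ} {x : ℝ → ℝ} (hx : CaputoClass p x) :
    VolterraPrimitive x :=
  ⟨x 0, deriv x, hx.zero.volterraClass_deriv, fun _ ht => hx.zero.eq_add_integral ht.le⟩

theorem VolterraClass.caputoClass_of_eq_integral {v y : ℝ → ℝ} (hv : VolterraClass v)
    (hy : ∀ t, 0 ≤ t → y t = ∫ τ in (0 : ℝ)..t, v τ) : CaputoClass 0 y := by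
  have hd (t : ℝ) (ht : 0 < t) : HasDerivAt y (v t) t := by
    refine (hv.hasDerivAt_integral ht).congr_of_eventuallyEq ?_
    filter_upwards [Ioi_mem_nhds ht] with x hx using hy x (le_of_lt hx)
  refine ⟨?_, ?_, fun T hT => ?_⟩
  · rw [Nat.cast_zero, contDiffOn_zero]
    refine ContinuousOn.congr (fun t ht => ?_) hy
    have ht : 0 ≤ t := ht
    have h1 : (0 : ℝ) < t + 1 := by linarith
    have hc := intervalIntegral.continuousOn_primitive_interval' (hv.integrable (t + 1) h1)
      left_mem_uIcc
    rw [uIcc_of_le h1.le] at hc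
    refine (hc t ⟨ht, by linarith⟩).mono_of_mem_nhdsWithin ?_
    filter_upwards [self_mem_nhdsWithin, nhdsWithin_le_nhds (Iic_mem_nhds (lt_add_one t))]
      with x hx hx' using ⟨hx, hx'⟩
  · rw [show (((0 + 1 : ℕ) : ℕ∞) : WithTop ℕ∞) = 0 + 1 by simp,
      contDiffOn_succ_iff_deriv_of_isOpen isOpen_Ioi]
    refine ⟨fun t ht => (hd t ht).differentiableAt.differentiableWithinAt, by simp, ?_⟩
    rw [contDiffOn_zero]
    exact hv.continuousOn.congr fun t ht => (hd t ht).deriv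
  · rw [zero_add, iteratedDeriv_one]
    refine (hv.integrable T hT).congr fun t ht => ?_
    rw [uIoc_of_le hT.le] at ht
    exact (hd t ht.1).deriv.symm

/-- The composition rule: a Caputo derivative of order `γ ≤ β` lowers the order of a fractional
integral `y = I^β g` that belongs to `CaputoClass 0` and vanishes at `0`. Both sides have the same
fractional integral of order `γ`, namely `y`. -/
theorem CaputoClass.caputoDeriv_eq_rlIntegral_of_eq {y g : ℝ → ℝ} {β γ : ℝ}
    (hy : CaputoClass 0 y) (hy0 : y 0 = 0) (hg : VolterraClass g) (hγ : 0 < γ) (hγ1 : γ ≤ 1)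
    (hγβ : γ ≤ β) (h : ∀ t, 0 < t → y t = rlIntegral β g t) {t : ℝ} (ht : 0 < t) :
    caputoDeriv γ y t = rlIntegral (β - γ) g t := by
  rw [caputoDeriv_eq_rlIntegral_deriv hγ hγ1]
  have hd := hy.volterraClass_deriv
  refine eq_of_rlIntegral_eq (hd.volterraClass_rlIntegral (sub_nonneg.2 hγ1))
    (hg.volterraClass_rlIntegral (sub_nonneg.2 hγβ))
    hγ.le hγ1 (fun x hx => ?_) ht
  rw [rlIntegral_rlIntegral hγ.le (sub_nonneg.2 hγ1) hd hx,
    rlIntegral_rlIntegral hγ.le (sub_nonneg.2 hγβ) hg hx, add_sub_cancel, add_sub_cancel,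
    rlIntegral_one, ← h x hx, hy.eq_add_integral hx.le, hy0, zero_add]

/-! ### The multi-term equation and the split system -/

theorem le_of_forall_lt_succ {m : ℕ} {α : ℕ → ℝ} (h : ∀ k, 1 ≤ k → k < m → α k < α (k + 1))
    {i j : ℕ} (hi : 1 ≤ i) (hij : i ≤ j) (hj : j ≤ m) : α i ≤ α j := by
  induction j, hij using Nat.le_induction with
  | base => exact le_rfl
  | succ j hij ih => exact (ih (by omega)).trans (h j (by omega) (by omega)).le

/-- In a solution of the split system the auxiliary functions are the Caputo derivatives of `x`, by
induction on the index with the composition rule. -/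
theorem SolvesSplitSystem.eq_caputoDeriv {p m : ℕ} {α a C : ℕ → ℝ} {x : ℝ → ℝ} {y : ℕ → ℝ → ℝ}
    (hm : 2 ≤ m) (hα_first : (p : ℝ) < α 1)
    (hα_lt : ∀ k, 1 ≤ k → k < m → α k < α (k + 1)) (hα_last : α m ≤ (p : ℝ) + 1)
    (hs : SolvesSplitSystem p m α a C x y) {j : ℕ} (h1 : 1 ≤ j) (hj : j ≤ m - 1) {t : ℝ}
    (ht : 0 < t) : y j t = caputoDeriv (α j) x t := by
  induction j, h1 using Nat.le_induction generalizing t with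
  | base => exact (hs.first t ht).symm
  | succ j h1 ih =>
    have l1 := le_of_forall_lt_succ hα_lt le_rfl h1 (by omega : j ≤ m)
    have l2 := le_of_forall_lt_succ hα_lt (by omega : 1 ≤ j + 1) (by omega : j + 1 ≤ m) le_rfl
    have l3 := hα_lt j h1 (by omega)
    rw [← hs.middle j h1 (by omega) t ht, caputoDeriv_eq_rlIntegral (p := p)
      (α := α (j + 1)) (by linarith) (by linarith),
      (hs.mem_y j h1 (by omega)).caputoDeriv_eq_rlIntegral_of_eq
      (hs.init_y j h1 (by omega)) hs.mem_x.volterraClass_iteratedDeriv (β := p + 1 - α j)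
      (by linarith) (by linarith) (by linarith) (fun u hu => ?_) ht]
    · congr 1; ring
    · rw [ih (by omega) hu, caputoDeriv_eq_rlIntegral (by linarith) (by linarith)]

theorem SolvesSplitSystem.solvesMultiTerm {p m : ℕ} {α a C : ℕ → ℝ} {x : ℝ → ℝ} {y : ℕ → ℝ → ℝ}
    (hm : 2 ≤ m) (ham : a m ≠ 0) (hα_first : (p : ℝ) < α 1)
    (hα_lt : ∀ k, 1 ≤ k → k < m → α k < α (k + 1)) (hα_last : α m ≤ (p : ℝ) + 1)
    (hs : SolvesSplitSystem p m α a C x y) : SolvesMultiTerm p m α a C x := by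
  refine ⟨hs.mem_x, hs.init_x, fun t ht => ?_⟩
  obtain ⟨n, rfl⟩ : ∃ n, m = n + 1 := ⟨m - 1, by omega⟩
  have hn : 1 ≤ n := by omega
  have hy (j : ℕ) (h1 : 1 ≤ j) (hj : j ≤ n) {t : ℝ} (ht : 0 < t) :
      y j t = caputoDeriv (α j) x t :=
    hs.eq_caputoDeriv hm hα_first hα_lt hα_last h1 hj ht
  have hlast := hs.last t ht
  rw [Nat.add_sub_cancel] at hlast
  have l1 := le_of_forall_lt_succ hα_lt le_rfl hn (Nat.le_succ n)
  have l3 := hα_lt n hn (Nat.lt_succ_self n)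
  rw [(hs.mem_y n hn (by omega)).caputoDeriv_eq_rlIntegral_of_eq
      (hs.init_y n hn (by omega)) hs.mem_x.volterraClass_iteratedDeriv (β := p + 1 - α n)
      (by linarith) (by linarith) (by linarith) (fun u hu => by
        rw [hy n hn le_rfl hu, caputoDeriv_eq_rlIntegral (by linarith) (by linarith)]) ht,
    show (p : ℝ) + 1 - α n - (α (n + 1) - α n) = p + 1 - α (n + 1) by ring,
    ← caputoDeriv_eq_rlIntegral (by linarith) hα_last,
    Finset.sum_congr rfl fun k hk => by
      rw [hy k (Finset.mem_Icc.1 hk).1 (Finset.mem_Icc.1 hk).2 ht]] at hlast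
  rw [Finset.sum_Icc_succ_top (by omega), hlast]
  field_simp
  ring

/-- A solution of the multi-term equation gives a solution of the split system. The point is that
the Caputo derivatives of order below `α_m` are regular enough to lie in `CaputoClass 0`; this
depends on the equation and can fail for other `x` of `CaputoClass p`. -/
theorem SolvesMultiTerm.solvesSplitSystem {p m : ℕ} {α a C : ℕ → ℝ} {x : ℝ → ℝ}
    (hm : 2 ≤ m) (ham : a m ≠ 0) (hα_first : (p : ℝ) < α 1)
    (hα_lt : ∀ k, 1 ≤ k → k < m → α k < α (k + 1)) (hα_last : α m ≤ (p : ℝ) + 1)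
    (hs : SolvesMultiTerm p m α a C x) :
    SolvesSplitSystem p m α a C x fun j => caputoDeriv (α j) x := by
  obtain ⟨n, rfl⟩ : ∃ n, m = n + 1 := ⟨m - 1, by omega⟩
  have hn : 1 ≤ n := by omega
  set g := iteratedDeriv (p + 1) x with hg_def
  have hg : VolterraClass g := hs.mem.volterraClass_iteratedDeriv
  have hfirst (j : ℕ) (h1 : 1 ≤ j) (hj : j ≤ n + 1) : (p : ℝ) < α j :=
    hα_first.trans_le (le_of_forall_lt_succ hα_lt le_rfl h1 hj)
  have hlast (j : ℕ) (h1 : 1 ≤ j) (hj : j ≤ n + 1) : α j ≤ (p : ℝ) + 1 :=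
    (le_of_forall_lt_succ hα_lt h1 hj le_rfl).trans hα_last
  have hlt (j : ℕ) (h1 : 1 ≤ j) (hj : j ≤ n) : α j < α (n + 1) :=
    (hα_lt j h1 (by omega)).trans_le (le_of_forall_lt_succ hα_lt (by omega) (by omega) le_rfl)
  have hD (j : ℕ) (h1 : 1 ≤ j) (hj : j ≤ n + 1) (t : ℝ) :
      caputoDeriv (α j) x t = rlIntegral (p + 1 - α j) g t :=
    caputoDeriv_eq_rlIntegral (hfirst j h1 hj) (hlast j h1 hj) x t
  -- The top-order term `h` satisfies a Volterra equation of the second kind.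
  set h := rlIntegral (p + 1 - α (n + 1)) g with hh_def
  have hh : VolterraClass h := hg.volterraClass_rlIntegral (sub_nonneg.2 hα_last)
  have hDh (j : ℕ) (h1 : 1 ≤ j) (hj : j ≤ n) (t : ℝ) (ht : 0 < t) :
      caputoDeriv (α j) x t = rlIntegral (α (n + 1) - α j) h t := by
    rw [hD j h1 (by omega), hh_def, rlIntegral_rlIntegral (by linarith [hlt j h1 hj])
      (sub_nonneg.2 hα_last) hg ht]
    congr 1; ring
  have heqn (t : ℝ) (ht : 0 < t) : h t =
      -(1 / a (n + 1)) * (a 0 * x t + ∑ k ∈ Finset.Icc 1 n, a k * caputoDeriv (α k) x t) := by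
    have := hs.eqn t ht
    rw [Finset.sum_Icc_succ_top (by omega), hD (n + 1) (by omega) le_rfl] at this
    field_simp
    linarith
  have hvolt (t : ℝ) (ht : 0 < t) : h t = -(1 / a (n + 1)) * a 0 * x t +
      ∑ k ∈ Finset.Icc 1 n, -(1 / a (n + 1)) * a k * rlIntegral (α (n + 1) - α k) h t := by
    rw [heqn t ht, mul_add, Finset.mul_sum, mul_assoc]
    congr 1
    refine Finset.sum_congr rfl fun k hk => ?_
    obtain ⟨h1, h2⟩ := Finset.mem_Icc.1 hk
    rw [hDh k h1 h2 t ht, mul_assoc]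
  have hprim : VolterraPrimitive h := by
    rw [← rlIntegral_zero h]
    refine volterraPrimitive_rlIntegral_of_eq hh
      (hs.mem.volterraPrimitive.const_mul (-(1 / a (n + 1)) * a 0)) (fun k hk => ?_) hvolt le_rfl
    obtain ⟨h1, h2⟩ := Finset.mem_Icc.1 hk
    linarith [hlt k h1 h2]
  have hinit (j : ℕ) (h1 : 1 ≤ j) (hj : j ≤ n) : caputoDeriv (α j) x 0 = 0 := by
    rw [hD j h1 (by omega), rlIntegral_of_ne (by linarith [hlt j h1 hj])]
    simp
  have hmem (j : ℕ) (h1 : 1 ≤ j) (hj : j ≤ n) : CaputoClass 0 (caputoDeriv (α j) x) := by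
    obtain ⟨w, hw, he⟩ := hprim.exists_rlIntegral_eq (sub_pos.2 (hlt j h1 hj))
    refine hw.caputoClass_of_eq_integral fun t ht => ?_
    rcases ht.eq_or_lt with rfl | ht
    · rw [hinit j h1 hj, intervalIntegral.integral_same]
    · rw [hDh j h1 hj t ht, he t ht]
  have hstep (j : ℕ) (h1 : 1 ≤ j) (hj : j ≤ n) (t : ℝ) (ht : 0 < t) :
      caputoDeriv (α (j + 1) - α j) (caputoDeriv (α j) x) t = caputoDeriv (α (j + 1)) x t := by
    have l1 := hfirst j h1 (by omega)
    have l2 := hlast (j + 1) (by omega) (by omega)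
    have l3 := hα_lt j h1 (by omega)
    rw [(hmem j h1 hj).caputoDeriv_eq_rlIntegral_of_eq (hinit j h1 hj) hg (by linarith)
      (by linarith) (by linarith) (fun u _ => hD j h1 (by omega) u) ht,
      hD (j + 1) (by omega) (by omega)]
    congr 1; ring
  refine ⟨hs.mem, fun j h1 hj => hmem j h1 hj, hs.init, fun j h1 hj => hinit j h1 hj,
    fun t _ => rfl, fun j h1 hj t ht => hstep j h1 (by omega) t ht, fun t ht => ?_⟩
  simp only [Nat.add_sub_cancel]
  rw [hstep n hn le_rfl t ht, hD (n + 1) (by omega) le_rfl, ← heqn t ht]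

theorem mainTheorem2 (p m : ℕ) (hm : 2 ≤ m) (α a C : ℕ → ℝ) (ham : a m ≠ 0)
    (hα_first : (p : ℝ) < α 1)
    (hα_lt : ∀ k, 1 ≤ k → k < m → α k < α (k + 1))
    (hα_last : α m ≤ (p : ℝ) + 1) :
    (∀ x : ℝ → ℝ,
      SolvesMultiTerm p m α a C x ↔ ∃ y : ℕ → ℝ → ℝ, SolvesSplitSystem p m α a C x y) ∧
    (∀ (x : ℝ → ℝ) (y : ℕ → ℝ → ℝ), SolvesSplitSystem p m α a C x y →
      ∀ j, 1 ≤ j → j ≤ m - 1 → ∀ t : ℝ, 0 < t → y j t = caputoDeriv (α j) x t) := by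
  refine ⟨fun x => ⟨fun h => ?_, fun ⟨y, h⟩ => ?_⟩, fun x y h j h1 hj t ht => ?_⟩
  · exact ⟨_, h.solvesSplitSystem hm ham hα_first hα_lt hα_last⟩
  · exact h.solvesMultiTerm hm ham hα_first hα_lt hα_last
  · exact h.eq_caputoDeriv hm hα_first hα_lt hα_last h1 hj ht
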